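/- For a Boolean function $f:\{-1,1\}^n\to\{-1,1\}$ and $S\subseteq\{1,\dots,n\}$ let $\hat f(S)=2^{-n}\sum_{x}f(x)\prod_{i\in S}x_i$. Each call to the Fourier sampling oracle $\mathrm{FS}(f)$ returns, independently of all other calls, each subset $S\subseteq\{1,\dots,n\}$ with probability $\hat f(S)^2$. The function $f$ is a $k$-junta if it depends only on at most $k$ of its $n$ variables, and it is $\epsilon$-far from every $k$-junta if for every $k$-junta $g:\{-1,1\}^n\to\{-1,1\}$ it differs from $g$ on at least an $\epsilon$ fraction of $\{-1,1\}^n$. An $\mathrm{FS}$-algorithm is a randomized, adaptive algorithm whose only access to the unknown $f$ is through calls to $\mathrm{FS}(f)$; it tests $k$-juntas with distance parameter $\epsilon$ if, for every $f:\{-1,1\}^n\to\{-1,1\}$, it accepts with probability at least $2/3$ when $f$ is a $k$-junta, and rejects with probability at least $2/3$ when $f$ is $\epsilon$-far from every $k$-junta. Theorem. Testing $k$-juntas requires $\Omega(\sqrt k)$ calls to the $\mathrm{FS}$ oracle. Precisely, there is an absolute constant $c>0$ such that for all integers $n,k\ge 0$ with $n\ge \tfrac32 k$ and all $0<\epsilon\le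 1/6$: if an $\mathrm{FS}$-algorithm tests $k$-juntas over $\{-1,1\}^n$ with distance parameter $\epsilon$ and, on every unknown function, makes at most $N$ oracle calls, then $N\ge c\sqrt k$. -/

import Mathlib

noncomputable section

/-- The Boolean cube `{-1,1}^n`; the units of `ℤ` are exactly `1` and `-1`. -/
abbrev Cube (n : ℕ) : Type := Fin n → ℤˣ

/-- Boolean functions `{-1,1}^n → {-1,1}`. -/
abbrev BoolFun (n : ℕ) : Type := Cube n → ℤˣ

/-- The parity function `χ_S(x) = ∏_{i ∈ S} x_i`. -/
def parity {n : ℕ} (S : Finset (Fin n)) (x : Cube n) : ℝ :=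
  ∏ i ∈ S, ((x i : ℤ) : ℝ)

/-- The Fourier coefficient `2^{-n} ∑_x f(x) χ_S(x)`. -/
def boolFourierCoeff {n : ℕ} (f : BoolFun n) (S : Finset (Fin n)) : ℝ :=
  (1 / 2 ^ n) * ∑ x : Cube n, ((f x : ℤ) : ℝ) * parity S x

theorem sum_parity_mul_parity {n : ℕ} (x y : Cube n) :
    ∑ S : Finset (Fin n), parity S x * parity S y = if x = y then (2 : ℝ) ^ n else 0 := by
  have h : ∑ S : Finset (Fin n), parity S x * parity S y
      = ∏ i : Fin n, (1 + ((x i : ℤ) : ℝ) * ((y i : ℤ) : ℝ)) := by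
    rw [Finset.prod_one_add, Finset.powerset_univ]
    simp only [parity, Finset.prod_mul_distrib]
  rw [h]
  split_ifs with hxy
  · subst hxy
    have : ∀ i : Fin n, (1 + ((x i : ℤ) : ℝ) * ((x i : ℤ) : ℝ)) = 2 := by
      intro i
      rcases Int.units_eq_one_or (x i) with hi | hi <;> rw [hi] <;> norm_num
    simp [this]
  · obtain ⟨i, hi⟩ := Function.ne_iff.mp hxy
    apply Finset.prod_eq_zero (Finset.mem_univ i)
    rcases Int.units_eq_one_or (x i) with h1 | h1 <;>
      rcases Int.units_eq_one_or (y i) with h2 | h2 <;> simp_all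

/-- Parseval's identity for Boolean functions. -/
theorem sum_boolFourierCoeff_sq {n : ℕ} (f : BoolFun n) :
    ∑ S : Finset (Fin n), boolFourierCoeff f S ^ 2 = 1 := by
  have h1 : ∀ S : Finset (Fin n), boolFourierCoeff f S ^ 2 =
      (1 / 2 ^ n) ^ 2 * ∑ x : Cube n, ∑ y : Cube n,
        ((f x : ℤ) : ℝ) * ((f y : ℤ) : ℝ) * (parity S x * parity S y) := by
    intro S
    rw [boolFourierCoeff, mul_pow, sq (∑ x : Cube n, _), Finset.sum_mul_sum]
    congr 1
    refine Finset.sum_congr rfl fun x _ => Finset.sum_congr rfl fun y _ => ?_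
    ring
  have h2 : ∑ S : Finset (Fin n), ∑ x : Cube n, ∑ y : Cube n,
        ((f x : ℤ) : ℝ) * ((f y : ℤ) : ℝ) * (parity S x * parity S y) =
      ∑ x : Cube n, (2 : ℝ) ^ n := by
    rw [Finset.sum_comm]
    refine Finset.sum_congr rfl fun x _ => ?_
    rw [Finset.sum_comm]
    simp only [← Finset.mul_sum, sum_parity_mul_parity]
    rcases Int.units_eq_one_or (f x) with h | h <;> simp [h]
  simp only [h1]
  rw [← Finset.mul_sum, h2]
  simp only [Finset.sum_const, Finset.card_univ, Fintype.card_fun, Fintype.card_units_int,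
    Fintype.card_fin, nsmul_eq_mul]
  push_cast
  field_simp

/-- The Fourier sampling oracle: the distribution of one response, which is
`S` with probability `|f̂(S)|²`. -/
def FS {n : ℕ} (f : BoolFun n) : PMF (Finset (Fin n)) :=
  PMF.ofFintype (fun S => ENNReal.ofReal (boolFourierCoeff f S ^ 2)) (by
    rw [← ENNReal.ofReal_sum_of_nonneg (fun S _ => sq_nonneg _), sum_boolFourierCoeff_sq,
      ENNReal.ofReal_one])

/-- `f` depends only on (at most) `k` of its `n` variables. -/
def IsJunta {n : ℕ} (k : ℕ) (f : BoolFun n) : Prop :=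
  ∃ J : Finset (Fin n), J.card ≤ k ∧ DependsOn f (J : Set (Fin n))

/-- The fraction of inputs on which `f` and `g` differ. -/
def relDist {n : ℕ} (f g : BoolFun n) : ℝ :=
  ((Finset.univ.filter fun x : Cube n => f x ≠ g x).card : ℝ) / 2 ^ n

/-- `f` is `ε`-far from every `k`-junta. -/
def FarFromJuntas {n : ℕ} (k : ℕ) (ε : ℝ) (f : BoolFun n) : Prop :=
  ∀ g : BoolFun n, IsJunta k g → ε ≤ relDist f g

/-- An arbitrary randomized, adaptive algorithm whose only access to the unknown function on `n`
variables is through calls to the Fourier sampling oracle. It either halts with an output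
(`true` for accept, `false` for reject), or uses internal randomness and continues depending on
the result, or calls the oracle (which takes no input) and continues depending on the response.
Internal computation is free and unrestricted. -/
inductive FSAlgorithm (n : ℕ) : Type
  | halt (output : Bool) : FSAlgorithm n
  | random (p : PMF ℕ) (next : ℕ → FSAlgorithm n) : FSAlgorithm n
  | call (next : Finset (Fin n) → FSAlgorithm n) : FSAlgorithm n

namespace FSAlgorithm

/-- The joint distribution of the output and of the number of oracle calls made when the
algorithm is run with the oracle `FS f`; responses to distinct calls are independent. -/
def run {n : ℕ} (f : BoolFun n) : FSAlgorithm n → PMF (Bool × ℕ)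
  | halt b => PMF.pure (b, 0)
  | random p next => p.bind fun i => run f (next i)
  | call next => (FS f).bind fun S => (run f (next S)).map fun o => (o.1, o.2 + 1)

/-- The distribution of the output when the unknown function is `f`. -/
def output {n : ℕ} (A : FSAlgorithm n) (f : BoolFun n) : PMF Bool :=
  (A.run f).map Prod.fst

/-- On every unknown function, no run of the algorithm that has positive probability makes more
than `N` oracle calls. -/
def MakesAtMost {n : ℕ} (A : FSAlgorithm n) (N : ℕ) : Prop :=
  ∀ f : BoolFun n, ∀ o ∈ (A.run f).support, o.2 ≤ N

/-- Property tester for `k`-juntas with distance parameter `ε`. -/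
def TestsJunta {n : ℕ} (A : FSAlgorithm n) (k : ℕ) (ε : ℝ) : Prop :=
  (∀ f : BoolFun n, IsJunta k f → 2 / 3 ≤ A.output f true) ∧
  (∀ f : BoolFun n, FarFromJuntas k ε f → 2 / 3 ≤ A.output f false)

end FSAlgorithm

end

noncomputable section

open FSAlgorithm

/-! Two families of random functions, one of `k`-juntas and one of functions far from them, are
indistinguishable to Fourier sampling until two samples collide. Both consist of addressing
functions `s x * y (π (τ x))`, with a fixed address map `τ`, a uniform permutation `π` of the data
bits and uniform signs `s`. A Fourier sample is always a set `addressSet T j`, and its data bit `j`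
has the law of `π (τ x)` for a uniform address `x`. Averaged over `π` and `s`, all response
sequences with distinct data bits are equally likely (`sum_responseProb_fresh_eq`), whatever `τ` is.
If no fiber of `τ` has more than a `4 / k` share of the addresses, the birthday bound makes the data
bits distinct except with probability `4 N ^ 2 / k`.

Reducing the address, read in binary, modulo `k - r` gives `k`-juntas. Reducing it modulo `3 t`,
slightly more than `3 (k - r) / 2`, gives functions that are `1 / 6`-far from `k`-juntas
(`farFromJuntas_addressing`). If `4 N ^ 2 / k < 1 / 6`, both the acceptance and the rejection
probability of a tester would average more than `1 / 2` over the same uniform fresh samples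
(`half_card_lt_sum_fresh`), although they add up to at most `1`. -/

/-! ### Algorithms as functions of the list of oracle responses -/

/-- The probability that the algorithm halts with output `b` when the oracle responses are
read off the list `l`; a run that asks for more responses than `l` holds contributes `0`. -/
def FSAlgorithm.outputOnList {n : ℕ} (b : Bool) :
    FSAlgorithm n → List (Finset (Fin n)) → ENNReal
  | halt b', _ => if b' = b then 1 else 0
  | random p next, l => ∑' i, p i * outputOnList b (next i) l
  | call _, [] => 0
  | call next, S :: l => outputOnList b (next S) l

theorem FSAlgorithm.outputOnList_add_le_one {n : ℕ} (A : FSAlgorithm n)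
    (l : List (Finset (Fin n))) :
    A.outputOnList true l + A.outputOnList false l ≤ 1 := by
  induction A generalizing l with
  | halt b => cases b <;> simp [outputOnList]
  | random p next ih =>
    simp only [outputOnList]
    rw [← ENNReal.tsum_add, ← p.tsum_coe]
    refine ENNReal.tsum_le_tsum fun i => ?_
    rw [← mul_add]
    exact mul_le_of_le_one_right' (ih i l)
  | call next ih =>
    cases l with
    | nil => simp [outputOnList]
    | cons S l => simpa only [outputOnList] using ih S l

theorem PMF.sum_prod_apply_eq_one {α : Type*} [Fintype α] [DecidableEq α] (p : PMF α) (N : ℕ) :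
    ∑ S : Fin N → α, ∏ i, p (S i) = 1 := by
  have h := Finset.prod_univ_sum (fun _ : Fin N => (Finset.univ : Finset α)) (fun _ a => p a)
  rw [Fintype.piFinset_univ] at h
  have hp : ∑ a, p a = 1 := by rw [← p.tsum_coe, tsum_fintype]
  rw [← h, hp]
  simp

/-- All `N` responses may be drawn in advance: a run making fewer calls ignores the tail, whose
probabilities sum to `1`. -/
theorem FSAlgorithm.output_eq_sum {n : ℕ} (f : BoolFun n) (b : Bool) (A : FSAlgorithm n) (N : ℕ)
    (hN : ∀ o ∈ (A.run f).support, o.2 ≤ N) :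
    A.output f b =
      ∑ S : Fin N → Finset (Fin n), (∏ i, FS f (S i)) * A.outputOnList b (List.ofFn S) := by
  induction A generalizing N with
  | halt b' =>
    simp only [output, run, PMF.pure_map, outputOnList, ← Finset.sum_mul,
      PMF.sum_prod_apply_eq_one, PMF.pure_apply, one_mul, eq_comm]
    split_ifs <;> rfl
  | random p next ih =>
    have h1 : (random p next).output f b = ∑' i, p i * (next i).output f b := by
      simp only [output, run, PMF.map_bind, PMF.bind_apply]
    have h2 : ∀ i, p i * (next i).output f b = p i * ∑ S : Fin N → Finset (Fin n),
        (∏ i, FS f (S i)) * (next i).outputOnList b (List.ofFn S) := by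
      intro i
      by_cases hi : p i = 0
      · simp [hi]
      · rw [ih i N]
        intro o ho
        refine hN o ?_
        simp only [run, PMF.mem_support_bind_iff]
        exact ⟨i, (PMF.mem_support_iff _ _).2 hi, ho⟩
    rw [h1, tsum_congr h2]
    simp only [outputOnList, Finset.mul_sum, ← ENNReal.tsum_mul_left]
    rw [Summable.tsum_finsetSum fun _ _ => ENNReal.summable]
    refine Finset.sum_congr rfl fun S _ => tsum_congr fun i => ?_
    ring
  | call next ih =>
    have hsupp : ∀ S, FS f S ≠ 0 → ∀ o ∈ ((next S).run f).support, o.2 + 1 ≤ N := by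
      intro S hS o ho
      refine hN (o.1, o.2 + 1) ?_
      simp only [run, PMF.mem_support_bind_iff, PMF.mem_support_map_iff]
      exact ⟨S, (PMF.mem_support_iff _ _).2 hS, o, ho, rfl⟩
    obtain ⟨S₀, hS₀⟩ := (FS f).support_nonempty
    obtain ⟨o₀, ho₀⟩ := ((next S₀).run f).support_nonempty
    have hpos := hsupp S₀ ((PMF.mem_support_iff _ _).1 hS₀) o₀ ho₀
    -- Some run with positive probability makes this call, so the call budget is not zero.
    obtain ⟨N, rfl⟩ : ∃ N', N = N' + 1 := ⟨N - 1, by omega⟩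
    have h1 : (call next).output f b = ∑ S, FS f S * (next S).output f b := by
      simp only [output, run, PMF.map_bind, PMF.bind_apply, PMF.map_comp, tsum_fintype]
      rfl
    rw [h1, ← (Fin.consEquiv fun _ => Finset (Fin n)).sum_comp, Fintype.sum_prod_type]
    refine Finset.sum_congr rfl fun S _ => ?_
    by_cases hS : FS f S = 0
    · simp [hS, Fin.prod_univ_succ, Fin.consEquiv]
    · rw [ih S N fun o ho => by have := hsupp S hS o ho; omega, Finset.mul_sum]
      refine Finset.sum_congr rfl fun T _ => ?_
      simp [Fin.prod_univ_succ, Fin.consEquiv, outputOnList, List.ofFn_succ, mul_assoc]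

/-- The real-valued form of `outputOnList`. -/
def FSAlgorithm.outputProb {n : ℕ} (A : FSAlgorithm n) (b : Bool) {N : ℕ}
    (S : Fin N → Finset (Fin n)) : ℝ :=
  (A.outputOnList b (List.ofFn S)).toReal

theorem FSAlgorithm.outputOnList_le_one {n : ℕ} (A : FSAlgorithm n) (b : Bool)
    (l : List (Finset (Fin n))) : A.outputOnList b l ≤ 1 := by
  have := A.outputOnList_add_le_one l
  cases b
  · exact le_trans le_add_self this
  · exact le_trans le_self_add this

theorem FSAlgorithm.outputProb_nonneg {n : ℕ} (A : FSAlgorithm n) (b : Bool) {N : ℕ}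
    (S : Fin N → Finset (Fin n)) : 0 ≤ A.outputProb b S := ENNReal.toReal_nonneg

theorem FSAlgorithm.outputProb_add_le_one {n : ℕ} (A : FSAlgorithm n) {N : ℕ}
    (S : Fin N → Finset (Fin n)) : A.outputProb true S + A.outputProb false S ≤ 1 := by
  have hne : ∀ b, A.outputOnList b (List.ofFn S) ≠ ⊤ := fun b =>
    ne_top_of_le_ne_top ENNReal.one_ne_top (A.outputOnList_le_one b _)
  rw [outputProb, outputProb, ← ENNReal.toReal_add (hne _) (hne _)]
  exact ENNReal.toReal_le_of_le_ofReal zero_le_one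
    (by simpa using A.outputOnList_add_le_one (List.ofFn S))

theorem FSAlgorithm.outputProb_le_one {n : ℕ} (A : FSAlgorithm n) (b : Bool) {N : ℕ}
    (S : Fin N → Finset (Fin n)) : A.outputProb b S ≤ 1 := by
  have := A.outputProb_add_le_one S
  have h0 := A.outputProb_nonneg true S
  have h1 := A.outputProb_nonneg false S
  cases b <;> linarith

theorem FSAlgorithm.two_thirds_le_sum {n : ℕ} {f : BoolFun n} {b : Bool} {A : FSAlgorithm n}
    {N : ℕ} (hN : A.MakesAtMost N) (h : 2 / 3 ≤ A.output f b) :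
    2 / 3 ≤ ∑ S : Fin N → Finset (Fin n),
      (∏ i, boolFourierCoeff f (S i) ^ 2) * A.outputProb b S := by
  have h1 := ENNReal.toReal_mono (PMF.apply_ne_top _ _) h
  rw [output_eq_sum f b A N (hN f), ENNReal.toReal_sum] at h1
  · simpa [ENNReal.toReal_mul, ENNReal.toReal_prod, FS, PMF.ofFintype_apply,
      ENNReal.toReal_ofReal, sq_nonneg, outputProb] using h1
  · intro S _
    refine ENNReal.mul_ne_top ?_ (ne_top_of_le_ne_top ENNReal.one_ne_top
      (A.outputOnList_le_one b _))
    exact ENNReal.prod_ne_top fun i _ => PMF.apply_ne_top _ _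

/-! ### Addressing functions -/

/-- The signed addressing function on `r` address bits `x` and `M` data bits `y`: at `(x, y)` it
returns the bit of `y` at position `τ x`, multiplied by `s x`. -/
def addressing {r M : ℕ} (τ : Cube r → Fin M) (s : Cube r → ℤˣ) : BoolFun (r + M) := fun z =>
  s (fun i => z (Fin.castAdd M i)) * z (Fin.natAdd r (τ fun i => z (Fin.castAdd M i)))

/-- The set of coordinates consisting of the address bits in `T` and the data bit `j`. -/
def addressSet {r M : ℕ} (T : Finset (Fin r)) (j : Fin M) : Finset (Fin (r + M)) :=
  insert (Fin.natAdd r j) (T.map (Fin.castAddEmb M))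

theorem natAdd_ne_castAdd {r M : ℕ} (j : Fin M) (i : Fin r) :
    Fin.natAdd r j ≠ Fin.castAdd M i := by
  intro h
  have := congrArg Fin.val h
  simp at this
  omega

theorem natAdd_notMem_map {r M : ℕ} (T : Finset (Fin r)) (j : Fin M) :
    Fin.natAdd r j ∉ T.map (Fin.castAddEmb M) := by
  simp only [Finset.mem_map, not_exists, not_and]
  exact fun i _ h => natAdd_ne_castAdd j i h.symm

theorem castAdd_mem_addressSet {r M : ℕ} {T : Finset (Fin r)} {j : Fin M} {i : Fin r} :
    Fin.castAdd M i ∈ addressSet T j ↔ i ∈ T := by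
  rw [addressSet, Finset.mem_insert, or_iff_right fun h => natAdd_ne_castAdd j i h.symm]
  exact Finset.mem_map' (Fin.castAddEmb M)

theorem natAdd_mem_addressSet {r M : ℕ} {T : Finset (Fin r)} {j j' : Fin M} :
    Fin.natAdd r j' ∈ addressSet T j ↔ j' = j := by
  rw [addressSet, Finset.mem_insert, or_iff_left (natAdd_notMem_map T j')]
  exact (Fin.natAdd_injective M r).eq_iff

theorem addressSet_inj {r M : ℕ} {T T' : Finset (Fin r)} {j j' : Fin M} :
    addressSet T j = addressSet T' j' ↔ T = T' ∧ j = j' := by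
  refine ⟨fun h => ⟨?_, ?_⟩, fun h => by rw [h.1, h.2]⟩
  · ext i
    rw [← castAdd_mem_addressSet (M := M) (j := j), h, castAdd_mem_addressSet]
  · rw [← natAdd_mem_addressSet (T := T'), ← h, natAdd_mem_addressSet]

theorem parity_addressSet {r M : ℕ} (T : Finset (Fin r)) (j : Fin M) (z : Cube (r + M)) :
    parity (addressSet T j) z =
      ((z (Fin.natAdd r j) : ℤ) : ℝ) * parity T fun i => z (Fin.castAdd M i) := by
  rw [parity, addressSet, Finset.prod_insert (natAdd_notMem_map T j), Finset.prod_map]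
  rfl

theorem intUnit_cast_mul_self (u : ℤˣ) : ((u : ℤ) : ℝ) * ((u : ℤ) : ℝ) = 1 := by
  rcases Int.units_eq_one_or u with h | h <;> simp [h]

/-- Negation of one coordinate of a point of the cube. -/
def flipAt {n : ℕ} (i : Fin n) (x : Cube n) : Cube n := Function.update x i (-x i)

@[simp] theorem flipAt_same {n : ℕ} (i : Fin n) (x : Cube n) : flipAt i x i = -x i := by
  simp [flipAt]

theorem flipAt_of_ne {n : ℕ} {i j : Fin n} (h : j ≠ i) (x : Cube n) : flipAt i x j = x j := by
  simp [flipAt, h]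

@[simp] theorem flipAt_flipAt {n : ℕ} (i : Fin n) (x : Cube n) : flipAt i (flipAt i x) = x := by
  simp [flipAt]

/-- Negation of a coordinate as a permutation of the cube. -/
def flipAtEquiv {n : ℕ} (i : Fin n) : Cube n ≃ Cube n :=
  Function.Involutive.toPerm (flipAt i) (flipAt_flipAt i)

theorem sum_flipAt {n : ℕ} (i : Fin n) (F : Cube n → ℝ) :
    ∑ x, F (flipAt i x) = ∑ x, F x :=
  (flipAtEquiv i).sum_comp F

theorem card_cube (n : ℕ) : (Finset.univ : Finset (Cube n)).card = 2 ^ n := by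
  simp [Finset.card_univ]

theorem sum_coord_mul_coord {M : ℕ} (a b : Fin M) :
    ∑ y : Cube M, ((y a : ℤ) : ℝ) * ((y b : ℤ) : ℝ) = if a = b then (2 : ℝ) ^ M else 0 := by
  split_ifs with h
  · subst h
    simp only [intUnit_cast_mul_self, Finset.sum_const, card_cube]
    simp
  · have h1 := sum_flipAt a fun y : Cube M => ((y a : ℤ) : ℝ) * ((y b : ℤ) : ℝ)
    simp only [flipAt_same, flipAt_of_ne (Ne.symm h)] at h1
    simp only [Units.val_neg, Int.cast_neg, neg_mul, Finset.sum_neg_distrib] at h1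
    linarith

/-- Summation over the cube in the address bits and the data bits separately. -/
theorem sum_cube_add {r M : ℕ} (F : Cube (r + M) → ℝ) :
    ∑ z, F z = ∑ x : Cube r, ∑ y : Cube M, F (Fin.append x y) := by
  rw [← (Fin.appendEquiv r M).sum_comp, Fintype.sum_prod_type]
  rfl

/-- Distinct data bits are orthogonal, so only addresses leading to `j` survive the summation over
`y`. -/
theorem boolFourierCoeff_addressing {r M : ℕ} (τ : Cube r → Fin M) (s : Cube r → ℤˣ)
    (T : Finset (Fin r)) (j : Fin M) :
    boolFourierCoeff (addressing τ s) (addressSet T j) =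
      (1 / 2 ^ r) * ∑ x, if τ x = j then ((s x : ℤ) : ℝ) * parity T x else 0 := by
  have h : ∀ x : Cube r, ∑ y : Cube M, ((addressing τ s (Fin.append x y) : ℤ) : ℝ) *
      parity (addressSet T j) (Fin.append x y) =
      2 ^ M * if τ x = j then ((s x : ℤ) : ℝ) * parity T x else 0 := by
    intro x
    have h1 : ∀ y : Cube M, ((addressing τ s (Fin.append x y) : ℤ) : ℝ) *
        parity (addressSet T j) (Fin.append x y) =
        ((s x : ℤ) : ℝ) * parity T x * (((y (τ x) : ℤ) : ℝ) * ((y j : ℤ) : ℝ)) := by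
      intro y
      rw [parity_addressSet, addressing]
      simp only [Fin.append_left, Fin.append_right, Units.val_mul, Int.cast_mul]
      ring
    simp only [h1, ← Finset.mul_sum, sum_coord_mul_coord]
    split_ifs <;> ring
  rw [boolFourierCoeff, sum_cube_add]
  simp only [h, ← Finset.mul_sum]
  rw [pow_add]
  field_simp

/-- The number of addresses that lead to the data bit `j`. -/
def fiberCard {r M : ℕ} (τ : Cube r → Fin M) (j : Fin M) : ℕ :=
  (Finset.univ.filter fun x => τ x = j).card

/-- Parseval on the address cube, for the sign function restricted to the fiber over `j`. These
weights total `1` over all `j`, so no Fourier mass lies on sets of another shape. -/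
theorem sum_boolFourierCoeff_addressing_sq {r M : ℕ} (τ : Cube r → Fin M) (s : Cube r → ℤˣ)
    (j : Fin M) :
    ∑ T, boolFourierCoeff (addressing τ s) (addressSet T j) ^ 2 = fiberCard τ j / 2 ^ r := by
  set a : Cube r → ℝ := fun x => if τ x = j then ((s x : ℤ) : ℝ) else 0 with ha
  have h1 : ∀ T, boolFourierCoeff (addressing τ s) (addressSet T j) ^ 2 =
      (1 / 2 ^ r) ^ 2 * ∑ x, ∑ x', a x * a x' * (parity T x * parity T x') := by
    intro T
    rw [boolFourierCoeff_addressing, mul_pow, sq (∑ x : Cube r, _), Finset.sum_mul_sum]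
    congr 1
    refine Finset.sum_congr rfl fun x _ => Finset.sum_congr rfl fun y _ => ?_
    simp only [ha]
    split_ifs <;> ring
  have h2 : ∑ T, ∑ x, ∑ x', a x * a x' * (parity T x * parity T x') =
      ∑ x, if τ x = j then (2 : ℝ) ^ r else 0 := by
    rw [Finset.sum_comm]
    refine Finset.sum_congr rfl fun x _ => ?_
    rw [Finset.sum_comm]
    simp only [← Finset.mul_sum, sum_parity_mul_parity]
    simp only [mul_ite, mul_zero, Finset.sum_ite_eq, Finset.mem_univ, if_true, ha]
    split_ifs
    · rw [intUnit_cast_mul_self, one_mul]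
    · simp
  simp only [h1]
  rw [← Finset.mul_sum, h2, ← Finset.sum_filter, Finset.sum_const, fiberCard, nsmul_eq_mul]
  field_simp

theorem sum_fiberCard {r M : ℕ} (τ : Cube r → Fin M) : ∑ j, fiberCard τ j = 2 ^ r := by
  rw [← card_cube r]
  exact (Finset.card_eq_sum_card_fiberwise fun x _ => Finset.mem_coe.2 (Finset.mem_univ (τ x))).symm

theorem fiberCard_perm_comp {r M : ℕ} (τ : Cube r → Fin M) (π : Equiv.Perm (Fin M)) (j : Fin M) :
    fiberCard (π ∘ τ) j = fiberCard τ (π.symm j) := by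
  simp only [fiberCard, Function.comp_apply, Equiv.eq_symm_apply]

/-! ### Collision-free samples -/

theorem sum_prod_ite_injective_succ {α : Type*} [Fintype α] [DecidableEq α] (p : α → ℝ) (N : ℕ) :
    ∑ j : Fin (N + 1) → α, (if Function.Injective j then ∏ i, p (j i) else 0) =
      ∑ j : Fin N → α, (if Function.Injective j then ∏ i, p (j i) else 0) *
        ∑ a, if a ∈ Finset.univ.image j then 0 else p a := by
  rw [← (Fin.consEquiv fun _ => α).sum_comp, Fintype.sum_prod_type, Finset.sum_comm]
  refine Finset.sum_congr rfl fun j _ => ?_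
  rw [Finset.mul_sum]
  refine Finset.sum_congr rfl fun a _ => ?_
  simp only [Fin.consEquiv, Equiv.coe_fn_mk, Fin.cons_injective_iff, Fin.prod_univ_succ,
    Fin.cons_zero, Fin.cons_succ, Set.mem_range, Finset.mem_image, Finset.mem_univ, true_and]
  by_cases h1 : ∃ y, j y = a <;> by_cases h2 : Function.Injective j <;> simp [h1, h2, mul_comm]

theorem sum_prod_eq_one {α : Type*} [Fintype α] [DecidableEq α] {p : α → ℝ} (h1 : ∑ a, p a = 1)
    (N : ℕ) : ∑ j : Fin N → α, ∏ i, p (j i) = 1 := by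
  have h := Finset.prod_univ_sum (fun _ : Fin N => (Finset.univ : Finset α)) (fun _ a => p a)
  rw [Fintype.piFinset_univ] at h
  rw [← h, h1]
  simp

/-- The birthday bound: `N` independent samples are pairwise distinct with probability at least
`1 - N ^ 2 * β` if no value has probability more than `β`. -/
theorem one_sub_le_sum_prod_ite_injective {α : Type*} [Fintype α] [DecidableEq α] {p : α → ℝ}
    {β : ℝ} (h0 : ∀ a, 0 ≤ p a) (h1 : ∑ a, p a = 1) (hβ0 : 0 ≤ β) (hβ : ∀ a, p a ≤ β) (N : ℕ) :
    1 - (N : ℝ) ^ 2 * β ≤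
      ∑ j : Fin N → α, (if Function.Injective j then ∏ i, p (j i) else 0) := by
  induction N with
  | zero => simp [Function.injective_of_subsingleton]
  | succ N ih =>
    rw [sum_prod_ite_injective_succ]
    -- The earlier samples occupy at most `N` values, each of probability at most `β`.
    have hfree : ∀ j : Fin N → α,
        1 - N * β ≤ ∑ a, if a ∈ Finset.univ.image j then 0 else p a := by
      intro j
      have hsplit : ∑ a, (if a ∈ Finset.univ.image j then 0 else p a) +
          ∑ a ∈ Finset.univ.image j, p a = 1 := by
        rw [← h1, ← Finset.sum_filter_add_sum_filter_not Finset.univ (· ∈ Finset.univ.image j) p,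
          add_comm]
        congr 1
        · congr 1
          ext a
          simp
        · simp only [Finset.sum_filter, ite_not]
      have hle : ∑ a ∈ Finset.univ.image j, p a ≤ N * β := by
        refine (Finset.sum_le_card_nsmul _ _ β fun a _ => hβ a).trans ?_
        rw [nsmul_eq_mul]
        refine mul_le_mul_of_nonneg_right ?_ hβ0
        exact_mod_cast Finset.card_image_le.trans (by simp)
      linarith
    have hw0 : ∀ j : Fin N → α, 0 ≤ if Function.Injective j then ∏ i, p (j i) else 0 := by
      intro j
      split_ifs
      · exact Finset.prod_nonneg fun i _ => h0 _
      · exact le_rfl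
    have hw1 : ∑ j : Fin N → α, (if Function.Injective j then ∏ i, p (j i) else 0) ≤ 1 := by
      rw [← sum_prod_eq_one h1 N]
      refine Finset.sum_le_sum fun j _ => ?_
      split_ifs
      · exact le_rfl
      · exact Finset.prod_nonneg fun i _ => h0 _
    have hstep := Finset.sum_le_sum fun (j : Fin N → α) (_ : j ∈ Finset.univ) =>
      mul_le_mul_of_nonneg_left (hfree j) (hw0 j)
    rw [← Finset.sum_mul] at hstep
    -- The loss of this step is at most `N * β`, and `N ^ 2 + N ≤ (N + 1) ^ 2`.
    refine le_trans ?_ hstep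
    have hNβ : 0 ≤ N * β := by positivity
    have := mul_le_mul_of_nonneg_right hw1 hNβ
    push_cast
    nlinarith

theorem sum_embedding_eq_sum_ite {α : Type*} [Fintype α] [DecidableEq α] {N : ℕ}
    (F : (Fin N → α) → ℝ) :
    ∑ j : Fin N ↪ α, F j = ∑ j : Fin N → α, if Function.Injective j then F j else 0 := by
  rw [← Finset.sum_filter, Finset.sum_subtype _ (p := Function.Injective) (by simp) F]
  exact ((Equiv.subtypeInjectiveEquivEmbedding (Fin N) α).sum_comp fun j => F j).symm

/-- Sequences of `N` sets `addressSet T j` with pairwise distinct data bits `j`. -/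
abbrev FreshSample (N r M : ℕ) : Type := (Fin N → Finset (Fin r)) × (Fin N ↪ Fin M)

/-- The oracle responses belonging to a fresh sample. -/
def FreshSample.responses {N r M : ℕ} (v : FreshSample N r M) : Fin N → Finset (Fin (r + M)) :=
  fun i => addressSet (v.1 i) (v.2 i)

theorem FreshSample.responses_injective {N r M : ℕ} :
    Function.Injective (FreshSample.responses : FreshSample N r M → _) := by
  intro v w h
  have h' := fun i => addressSet_inj.1 (congrFun h i)
  exact Prod.ext (funext fun i => (h' i).1) (DFunLike.ext _ _ fun i => (h' i).2)

/-- The probability that independent calls to `FS f` return the responses `S`. -/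
def responseProb {n N : ℕ} (f : BoolFun n) (S : Fin N → Finset (Fin n)) : ℝ :=
  ∏ i, boolFourierCoeff f (S i) ^ 2

theorem responseProb_nonneg {n N : ℕ} (f : BoolFun n) (S : Fin N → Finset (Fin n)) :
    0 ≤ responseProb f S :=
  Finset.prod_nonneg fun _ _ => sq_nonneg _

theorem sum_responseProb {n : ℕ} (f : BoolFun n) (N : ℕ) :
    ∑ S : Fin N → Finset (Fin n), responseProb f S = 1 :=
  sum_prod_eq_one (sum_boolFourierCoeff_sq f) N

theorem one_sub_le_sum_responseProb_fresh {r M N : ℕ} (τ : Cube r → Fin M) (s : Cube r → ℤˣ)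
    {β : ℝ} (hβ0 : 0 ≤ β) (hβ : ∀ j, fiberCard τ j / 2 ^ r ≤ β) :
    1 - (N : ℝ) ^ 2 * β ≤
      ∑ v : FreshSample N r M, responseProb (addressing τ s) v.responses := by
  have h : ∀ j : Fin N ↪ Fin M, ∑ T : Fin N → Finset (Fin r),
      responseProb (addressing τ s) (FreshSample.responses (T, j)) =
      ∏ i, (fiberCard τ (j i) / 2 ^ r : ℝ) := by
    intro j
    simp only [← sum_boolFourierCoeff_addressing_sq τ s]
    rw [Finset.prod_univ_sum, Fintype.piFinset_univ]
    rfl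
  rw [Fintype.sum_prod_type, Finset.sum_comm]
  simp only [h]
  rw [sum_embedding_eq_sum_ite fun j => ∏ i, (fiberCard τ (j i) / 2 ^ r : ℝ)]
  refine one_sub_le_sum_prod_ite_injective (fun j => by positivity) ?_ hβ0 hβ N
  rw [← Finset.sum_div, ← Nat.cast_sum, sum_fiberCard]
  simp

theorem sum_fresh_le_sum {r M N : ℕ} (F : (Fin N → Finset (Fin (r + M))) → ℝ)
    (hF : ∀ S, 0 ≤ F S) : ∑ v : FreshSample N r M, F v.responses ≤ ∑ S, F S := by
  have h := Finset.sum_map Finset.univ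
    (⟨_, FreshSample.responses_injective⟩ : FreshSample N r M ↪ _) F
  exact h.symm.trans_le (Finset.sum_le_univ_sum_of_nonneg hF)

/-! ### Symmetry of random addressing functions -/

/-- The parity function with values in the units of `ℤ`. -/
def unitParity {n : ℕ} (S : Finset (Fin n)) (x : Cube n) : ℤˣ := ∏ i ∈ S, x i

theorem coe_unitParity {n : ℕ} (S : Finset (Fin n)) (x : Cube n) :
    ((unitParity S x : ℤ) : ℝ) = parity S x := by
  simp [unitParity, parity, Units.coe_prod]

/-- The likelihood of a fresh sample under a random addressing function does not depend on the
sample: the data bits can be permuted, and the signs can be twisted on each fiber of `τ`. -/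
theorem sum_responseProb_fresh_eq {r M N : ℕ} (τ : Cube r → Fin M) (v w : FreshSample N r M) :
    ∑ π : Equiv.Perm (Fin M), ∑ s : Cube r → ℤˣ,
        responseProb (addressing (π ∘ τ) s) v.responses =
      ∑ π : Equiv.Perm (Fin M), ∑ s : Cube r → ℤˣ,
        responseProb (addressing (π ∘ τ) s) w.responses := by
  -- The symmetric group is `N`-transitive: `ρ` carries the data bits of `v` to those of `w`.
  obtain ⟨ρ, hρ⟩ := MulAction.isMultiplyPretransitive_iff.1
    (Equiv.Perm.isMultiplyPretransitive (Fin M) N) v.2 w.2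
  have hρ' : ∀ i, ρ (v.2 i) = w.2 i := fun i => DFunLike.congr_fun hρ i
  -- On the fiber over the `i`-th data bit of `v`, multiplying `s` by both parities exchanges `v.1
  -- i` for `w.1 i` in the Fourier coefficient. The data bits are distinct, so these twists do not
  -- conflict.
  let U : Fin M → Cube r → ℤˣ :=
    Function.extend v.2 (fun i x => unitParity (v.1 i) x * unitParity (w.1 i) x) 1
  have hU : ∀ i x, U (v.2 i) x = unitParity (v.1 i) x * unitParity (w.1 i) x := fun i x =>
    congrFun (v.2.injective.extend_apply _ _ i) x
  rw [← Equiv.sum_comp (Equiv.mulLeft ρ) fun π : Equiv.Perm (Fin M) => ∑ s : Cube r → ℤˣ,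
        responseProb (addressing (π ∘ τ) s) w.responses]
  refine Finset.sum_congr rfl fun π _ => ?_
  rw [← Equiv.sum_comp (Equiv.mulRight fun x => U (π (τ x)) x) fun s : Cube r → ℤˣ =>
        responseProb (addressing (Equiv.mulLeft ρ π ∘ τ) s) w.responses]
  refine Finset.sum_congr rfl fun s _ => Finset.prod_congr rfl fun i _ => ?_
  simp only [FreshSample.responses, boolFourierCoeff_addressing]
  congr 2
  refine Finset.sum_congr rfl fun x _ => ?_
  have hiff : (Equiv.mulLeft ρ π ∘ τ) x = w.2 i ↔ (π ∘ τ) x = v.2 i := by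
    rw [← hρ']
    exact ρ.injective.eq_iff
  rw [if_congr hiff rfl rfl]
  split_ifs with hx
  · have hx' : π (τ x) = v.2 i := hx
    simp only [Equiv.coe_mulRight, Pi.mul_apply, hx', hU, Units.val_mul, Int.cast_mul]
    rw [← coe_unitParity, ← coe_unitParity, mul_assoc, mul_assoc, intUnit_cast_mul_self, mul_one]
  · rfl

/-- If a statistic of `N` oracle responses is at least `2 / 3` on average for each addressing
function of a family, its average over all fresh samples exceeds `1 / 2`. -/
theorem half_card_lt_sum_fresh {r M N : ℕ} (τ : Cube r → Fin M) {β : ℝ} (hβ0 : 0 ≤ β)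
    (hβ : ∀ j, fiberCard τ j / 2 ^ r ≤ β) (hNβ : (N : ℝ) ^ 2 * β < 1 / 6)
    {w : (Fin N → Finset (Fin (r + M))) → ℝ} (hw1 : ∀ S, w S ≤ 1)
    (hw : ∀ (π : Equiv.Perm (Fin M)) (s : Cube r → ℤˣ),
      2 / 3 ≤ ∑ S, responseProb (addressing (π ∘ τ) s) S * w S) :
    (Fintype.card (FreshSample N r M) : ℝ) / 2 < ∑ v : FreshSample N r M, w v.responses := by
  have hfiber : ∀ π : Equiv.Perm (Fin M), ∀ j, (fiberCard (π ∘ τ) j / 2 ^ r : ℝ) ≤ β := by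
    intro π j
    rw [fiberCard_perm_comp]
    exact hβ _
  have hlow : ∀ (π : Equiv.Perm (Fin M)) (s : Cube r → ℤˣ), 1 / 2 <
      ∑ v : FreshSample N r M, responseProb (addressing (π ∘ τ) s) v.responses *
        w v.responses := by
    intro π s
    have h1 := one_sub_le_sum_responseProb_fresh (N := N) (π ∘ τ) s hβ0 (hfiber π)
    -- Fresh samples carry mass above `5 / 6`, and `1 - w` costs at most `1 / 3` in total, which
    -- leaves more than `1 / 2`.
    have h2 := sum_fresh_le_sum (N := N)
      (fun S => responseProb (addressing (π ∘ τ) s) S * (1 - w S))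
      fun S => mul_nonneg (responseProb_nonneg _ _) (sub_nonneg.2 (hw1 S))
    simp only [mul_sub, mul_one, Finset.sum_sub_distrib, sum_responseProb] at h2
    linarith [hw π s]
  have htotal : ∀ (π : Equiv.Perm (Fin M)) (s : Cube r → ℤˣ),
      ∑ v : FreshSample N r M, responseProb (addressing (π ∘ τ) s) v.responses ≤ 1 := by
    intro π s
    rw [← sum_responseProb (addressing (π ∘ τ) s) N]
    exact sum_fresh_le_sum _ (responseProb_nonneg _)
  let Ω := Equiv.Perm (Fin M) × (Cube r → ℤˣ)
  let L : FreshSample N r M → ℝ := fun v =>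
    ∑ ω : Ω, responseProb (addressing (ω.1 ∘ τ) ω.2) v.responses
  have hL : ∀ v v', L v = L v' := by
    intro v v'
    simp only [L, Ω, Fintype.sum_prod_type]
    exact sum_responseProb_fresh_eq τ v v'
  have hΩ : (0 : ℝ) < Fintype.card Ω := by exact_mod_cast Fintype.card_pos
  have hbig : (Fintype.card Ω : ℝ) / 2 < ∑ v, L v * w v.responses := by
    simp only [L, Finset.sum_mul]
    rw [Finset.sum_comm]
    refine lt_of_le_of_lt (le_of_eq ?_) (Finset.sum_lt_sum_of_nonempty Finset.univ_nonempty
      fun (ω : Ω) _ => hlow ω.1 ω.2)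
    simp [div_eq_mul_inv]
  have hsmall : ∑ v, L v ≤ Fintype.card Ω := by
    simp only [L]
    rw [Finset.sum_comm]
    refine (Finset.sum_le_sum fun (ω : Ω) _ => htotal ω.1 ω.2).trans (le_of_eq ?_)
    simp
  rcases isEmpty_or_nonempty (FreshSample N r M) with hV | ⟨⟨v₀⟩⟩
  · simp only [Finset.univ_eq_empty, Finset.sum_empty] at hbig
    linarith
  · simp only [hL _ v₀, ← Finset.mul_sum] at hbig
    simp only [hL _ v₀, Finset.sum_const, Finset.card_univ, nsmul_eq_mul] at hsmall
    by_contra hcon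
    have h0 : 0 ≤ L v₀ := Finset.sum_nonneg fun ω _ => responseProb_nonneg _ _
    have := mul_le_mul_of_nonneg_left (not_lt.1 hcon) h0
    linarith

/-! ### Juntas and distance from juntas -/

theorem relDist_eq {n : ℕ} (f g : BoolFun n) :
    relDist f g = (1 - (∑ z, ((f z : ℤ) : ℝ) * ((g z : ℤ) : ℝ)) / 2 ^ n) / 2 := by
  have h : ∀ z, ((f z : ℤ) : ℝ) * ((g z : ℤ) : ℝ) = 1 - 2 * if f z ≠ g z then 1 else 0 := by
    intro z
    rcases Int.units_eq_one_or (f z) with h1 | h1 <;>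
      rcases Int.units_eq_one_or (g z) with h2 | h2 <;> rw [h1, h2] <;> norm_num
  have hsum : ∑ z, ((f z : ℤ) : ℝ) * ((g z : ℤ) : ℝ) =
      2 ^ n - 2 * (Finset.univ.filter fun z : Cube n => f z ≠ g z).card := by
    simp only [h]
    rw [Finset.sum_sub_distrib, ← Finset.mul_sum, Finset.sum_boole, Finset.sum_const, card_cube]
    simp
  rw [hsum, relDist]
  field_simp
  ring

theorem eq_flipAt_of_dependsOn {n : ℕ} {g : BoolFun n} {J : Finset (Fin n)}
    (hg : DependsOn g (J : Set (Fin n))) {i : Fin n} (hi : i ∉ J) (z : Cube n) :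
    g (flipAt i z) = g z := by
  refine hg fun j hj => flipAt_of_ne ?_ z
  rintro rfl
  exact hi hj

theorem isJunta_one {n : ℕ} (k : ℕ) : IsJunta k (1 : BoolFun n) :=
  ⟨∅, by simp, fun _ _ _ => rfl⟩

/-- The product of all coordinates is far from every junta on fewer variables. -/
theorem farFromJuntas_prod {n k : ℕ} (hk : k < n) {ε : ℝ} (hε : ε ≤ 1 / 6) :
    FarFromJuntas k ε (fun z : Cube n => ∏ i, z i) := by
  rintro g ⟨J, hJ, hg⟩
  obtain ⟨i, hi⟩ : ∃ i, i ∉ J := by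
    by_contra h
    push Not at h
    have : J = Finset.univ := Finset.eq_univ_iff_forall.2 h
    rw [this, Finset.card_univ, Fintype.card_fin] at hJ
    omega
  have hf : ∀ z : Cube n, ∏ l, flipAt i z l = -∏ l, z l := by
    intro z
    rw [← Finset.mul_prod_erase _ _ (Finset.mem_univ i),
      ← Finset.mul_prod_erase _ z (Finset.mem_univ i), flipAt_same, neg_mul]
    congr 2
    exact Finset.prod_congr rfl fun l hl => flipAt_of_ne (Finset.ne_of_mem_erase hl) z
  have h := sum_flipAt i fun z => (((∏ l, z l : ℤˣ) : ℤ) : ℝ) * ((g z : ℤ) : ℝ)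
  simp only [hf, eq_flipAt_of_dependsOn hg hi, Units.val_neg, Int.cast_neg, neg_mul,
    Finset.sum_neg_distrib] at h
  rw [relDist_eq, show ∑ z, (((∏ l, z l : ℤˣ) : ℤ) : ℝ) * ((g z : ℤ) : ℝ) = 0 by linarith]
  norm_num
  linarith

theorem isJunta_addressing {r M k : ℕ} (τ : Cube r → Fin M) (s : Cube r → ℤˣ)
    (B : Finset (Fin M)) (hτ : ∀ x, τ x ∈ B) (hk : r + B.card ≤ k) :
    IsJunta k (addressing τ s) := by
  refine ⟨Finset.univ.map (Fin.castAddEmb M) ∪ B.map (Fin.natAddEmb r), ?_, ?_⟩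
  · refine (Finset.card_union_le _ _).trans ?_
    simpa using hk
  · intro z z' h
    have hx : (fun i => z (Fin.castAdd M i)) = fun i => z' (Fin.castAdd M i) := by
      funext i
      refine h _ ?_
      simp only [Finset.coe_union, Set.mem_union, Finset.mem_coe]
      exact Or.inl (Finset.mem_map_of_mem (Fin.castAddEmb M) (Finset.mem_univ i))
    unfold addressing
    rw [hx]
    congr 1
    refine h _ ?_
    simp only [Finset.coe_union, Set.mem_union, Finset.mem_coe]
    exact Or.inr (Finset.mem_map_of_mem (Fin.natAddEmb r) (hτ _))

theorem flipAt_natAdd_castAdd {r M : ℕ} (j : Fin M) (z : Cube (r + M)) :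
    (fun i : Fin r => flipAt (Fin.natAdd r j) z (Fin.castAdd M i)) =
      fun i => z (Fin.castAdd M i) :=
  funext fun i => flipAt_of_ne (natAdd_ne_castAdd j i).symm z

theorem flipAt_castAdd_castAdd {r M : ℕ} (i : Fin r) (z : Cube (r + M)) :
    (fun l : Fin r => flipAt (Fin.castAdd M i) z (Fin.castAdd M l)) =
      flipAt i fun l => z (Fin.castAdd M l) := by
  funext l
  by_cases h : l = i
  · subst h
    simp
  · rw [flipAt_of_ne h, flipAt_of_ne fun h' => h (Fin.castAdd_injective r M h')]

/-- A function that ignores an address bit has correlation at most `1 / 2` with an addressing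
function for which neighbouring addresses lead to different data bits. -/
theorem sum_addressing_mul_le_of_castAdd_notMem {r M : ℕ} (τ : Cube r → Fin M) (s : Cube r → ℤˣ)
    (hτ : ∀ x i, τ (flipAt i x) ≠ τ x) {g : BoolFun (r + M)} {J : Finset (Fin (r + M))}
    (hg : DependsOn g (J : Set (Fin (r + M)))) {i : Fin r} (hi : Fin.castAdd M i ∉ J) :
    ∑ z, ((addressing τ s z : ℤ) : ℝ) * ((g z : ℤ) : ℝ) ≤ 2 ^ (r + M) / 2 := by
  set f := addressing τ s with hf
  set e := Fin.castAdd M i with he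
  -- Flipping the address bit leads to a different data bit, so `f` is orthogonal to its flipped
  -- copy.
  have hauto : ∑ z, ((f z : ℤ) : ℝ) * ((f (flipAt e z) : ℤ) : ℝ) = 0 := by
    rw [sum_cube_add]
    refine Finset.sum_eq_zero fun x _ => ?_
    have h1 : ∀ y : Cube M, ((f (Fin.append x y) : ℤ) : ℝ) *
        ((f (flipAt e (Fin.append x y)) : ℤ) : ℝ) =
        ((s x : ℤ) : ℝ) * ((s (flipAt i x) : ℤ) : ℝ) *
          (((y (τ x) : ℤ) : ℝ) * ((y (τ (flipAt i x)) : ℤ) : ℝ)) := by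
      intro y
      simp only [hf, addressing, he, flipAt_castAdd_castAdd, Fin.append_left,
        flipAt_of_ne (natAdd_ne_castAdd _ _), Fin.append_right, Units.val_mul, Int.cast_mul]
      ring
    simp only [h1, ← Finset.mul_sum, sum_coord_mul_coord, if_neg (hτ x i).symm, mul_zero]
  have hflip := sum_flipAt e fun z => ((f z : ℤ) : ℝ) * ((g z : ℤ) : ℝ)
  simp only [eq_flipAt_of_dependsOn hg hi] at hflip
  -- For signs, `(a + b) * c ≤ |a + b| = 1 + a * b`.
  have hpt : ∀ z, ((f z : ℤ) : ℝ) * ((g z : ℤ) : ℝ) + ((f (flipAt e z) : ℤ) : ℝ) * ((g z : ℤ) : ℝ)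
      ≤ 1 + ((f z : ℤ) : ℝ) * ((f (flipAt e z) : ℤ) : ℝ) := by
    intro z
    rcases Int.units_eq_one_or (f z) with h1 | h1 <;>
      rcases Int.units_eq_one_or (g z) with h2 | h2 <;>
        rcases Int.units_eq_one_or (f (flipAt e z)) with h3 | h3 <;> rw [h1, h2, h3] <;> norm_num
  have hsum := Finset.sum_le_sum fun z (_ : z ∈ Finset.univ) => hpt z
  rw [Finset.sum_add_distrib, Finset.sum_add_distrib, hauto, hflip, Finset.sum_const, card_cube,
    nsmul_eq_mul] at hsum
  push_cast at hsum
  linarith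

/-- The correlation of an addressing function with a function of the variables in `J` is at most
the fraction of addresses leading into `J`. -/
theorem sum_addressing_mul_le {r M : ℕ} (τ : Cube r → Fin M) (s : Cube r → ℤˣ)
    {g : BoolFun (r + M)} {J : Finset (Fin (r + M))}
    (hg : DependsOn g (J : Set (Fin (r + M)))) :
    ∑ z, ((addressing τ s z : ℤ) : ℝ) * ((g z : ℤ) : ℝ) ≤
      2 ^ M * (Finset.univ.filter fun x => Fin.natAdd r (τ x) ∈ J).card := by
  set f := addressing τ s with hf
  have hx : ∀ x : Cube r, ∑ y : Cube M, ((f (Fin.append x y) : ℤ) : ℝ) *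
      ((g (Fin.append x y) : ℤ) : ℝ) ≤ if Fin.natAdd r (τ x) ∈ J then 2 ^ M else 0 := by
    intro x
    split_ifs with h
    · have : ∀ y : Cube M, ((f (Fin.append x y) : ℤ) : ℝ) * ((g (Fin.append x y) : ℤ) : ℝ) ≤ 1 := by
        intro y
        rcases Int.units_eq_one_or (f (Fin.append x y)) with h1 | h1 <;>
          rcases Int.units_eq_one_or (g (Fin.append x y)) with h2 | h2 <;> rw [h1, h2] <;> norm_num
      refine (Finset.sum_le_sum fun y _ => this y).trans (le_of_eq ?_)
      rw [Finset.sum_const, card_cube]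
      simp
    -- If the addressed data bit is outside `J`, negating it negates `f` and fixes `g`, so the sum
    -- over `y` vanishes.
    · have happ : ∀ y : Cube M, Fin.append x (flipAt (τ x) y) =
          flipAt (Fin.natAdd r (τ x)) (Fin.append x y) := by
        intro y
        funext l
        refine Fin.addCases (fun i => ?_) (fun j => ?_) l
        · rw [flipAt_of_ne (natAdd_ne_castAdd _ _).symm, Fin.append_left, Fin.append_left]
        · by_cases hj : j = τ x
          · subst hj
            simp
          · rw [flipAt_of_ne fun h' => hj (Fin.natAdd_injective M r h'), Fin.append_right,
              Fin.append_right, flipAt_of_ne hj]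
      have hfneg : ∀ y : Cube M, f (flipAt (Fin.natAdd r (τ x)) (Fin.append x y)) =
          -f (Fin.append x y) := by
        intro y
        simp only [hf, addressing, flipAt_natAdd_castAdd, Fin.append_left, flipAt_same, mul_neg]
      have hflip := sum_flipAt (τ x) fun y => ((f (Fin.append x y) : ℤ) : ℝ) *
        ((g (Fin.append x y) : ℤ) : ℝ)
      simp only [happ, hfneg, eq_flipAt_of_dependsOn hg h, Units.val_neg, Int.cast_neg, neg_mul,
        Finset.sum_neg_distrib] at hflip
      linarith
  rw [sum_cube_add]
  refine (Finset.sum_le_sum fun x _ => hx x).trans (le_of_eq ?_)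
  rw [← Finset.sum_filter, Finset.sum_const, nsmul_eq_mul, mul_comm]

/-- Either the junta ignores an address bit, and the correlation is at most `1 / 2`, or it spends
`r` variables on the address and reads at most `k - r` data bits. By `hcov` those are reached from
at most `2 / 3` of the addresses. Correlation at most `2 / 3` means distance at least `1 / 6`. -/
theorem farFromJuntas_addressing {r M k F : ℕ} (τ : Cube r → Fin M) (s : Cube r → ℤˣ)
    (hτ : ∀ x i, τ (flipAt i x) ≠ τ x) (hF : ∀ j, fiberCard τ j ≤ F)
    (hcov : 3 * ((k - r) * F) ≤ 2 * 2 ^ r) {ε : ℝ} (hε : ε ≤ 1 / 6) :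
    FarFromJuntas k ε (addressing τ s) := by
  rintro g ⟨J, hJ, hg⟩
  suffices h : ∑ z, ((addressing τ s z : ℤ) : ℝ) * ((g z : ℤ) : ℝ) ≤ 2 / 3 * 2 ^ (r + M) by
    rw [relDist_eq]
    have h2 : (∑ z, ((addressing τ s z : ℤ) : ℝ) * ((g z : ℤ) : ℝ)) / 2 ^ (r + M) ≤ 2 / 3 :=
      (div_le_iff₀ (by positivity)).2 h
    linarith
  by_cases hall : ∀ i : Fin r, Fin.castAdd M i ∈ J
  · refine (sum_addressing_mul_le τ s hg).trans ?_
    set B : Finset (Fin M) := Finset.univ.filter fun j => Fin.natAdd r j ∈ J with hB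
    have hBcard : r + B.card ≤ k := by
      refine le_trans ?_ hJ
      have hdisj : Disjoint ((Finset.univ : Finset (Fin r)).map (Fin.castAddEmb M))
          (B.map (Fin.natAddEmb r)) := by
        rw [Finset.disjoint_left]
        intro a ha hb
        obtain ⟨j, _, rfl⟩ := Finset.mem_map.1 hb
        exact natAdd_notMem_map _ j ha
      have hsub : (Finset.univ : Finset (Fin r)).map (Fin.castAddEmb M) ∪
          B.map (Fin.natAddEmb r) ⊆ J := by
        intro a ha
        rcases Finset.mem_union.1 ha with ha | ha
        · obtain ⟨i, _, rfl⟩ := Finset.mem_map.1 ha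
          exact hall i
        · obtain ⟨j, hj, rfl⟩ := Finset.mem_map.1 ha
          exact (Finset.mem_filter.1 hj).2
      have := Finset.card_le_card hsub
      rw [Finset.card_union_of_disjoint hdisj] at this
      simpa using this
    have hcount : (Finset.univ.filter fun x => Fin.natAdd r (τ x) ∈ J).card ≤ B.card * F := by
      have hmaps : Set.MapsTo τ (Finset.univ.filter fun x => Fin.natAdd r (τ x) ∈ J : Finset _)
          (B : Set (Fin M)) := by
        intro x hx
        simpa [hB] using hx
      rw [Finset.card_eq_sum_card_fiberwise hmaps, ← smul_eq_mul]
      refine Finset.sum_le_card_nsmul _ _ _ fun j _ => le_trans ?_ (hF j)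
      refine Finset.card_le_card fun x hx => ?_
      simpa using (Finset.mem_filter.1 hx).2
    have h1 : 3 * (Finset.univ.filter fun x => Fin.natAdd r (τ x) ∈ J).card ≤ 2 * 2 ^ r :=
      (Nat.mul_le_mul_left 3 (hcount.trans (Nat.mul_le_mul_right F (by omega)))).trans hcov
    have h2 : 3 * ((Finset.univ.filter fun x => Fin.natAdd r (τ x) ∈ J).card : ℝ) ≤ 2 * 2 ^ r := by
      exact_mod_cast h1
    rw [pow_add]
    have h3 : (0 : ℝ) < 2 ^ M := by positivity
    nlinarith
  · push Not at hall
    obtain ⟨i, hi⟩ := hall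
    refine (sum_addressing_mul_le_of_castAdd_notMem τ s hτ hg hi).trans ?_
    have : (0 : ℝ) < 2 ^ (r + M) := by positivity
    linarith

/-! ### Balanced address maps -/

/-- The two signs as binary digits. -/
def signDigit : ℤˣ ≃ Fin 2 := Fintype.equivFinOfCardEq Fintype.card_units_int

/-- The points of the cube as numbers written in binary. -/
def cubeIndex (r : ℕ) : Cube r ≃ Fin (2 ^ r) :=
  (Equiv.arrowCongr (Equiv.refl (Fin r)) signDigit).trans finFunctionFinEquiv

theorem cubeIndex_val {r : ℕ} (x : Cube r) :
    (cubeIndex r x : ℕ) = ∑ i, (signDigit (x i) : ℕ) * 2 ^ (i : ℕ) := by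
  simp [cubeIndex]

theorem cubeIndex_flipAt {r : ℕ} (i : Fin r) (x : Cube r) :
    ((cubeIndex r (flipAt i x) : ℕ) : ℤ) = cubeIndex r x + 2 ^ (i : ℕ) ∨
      ((cubeIndex r (flipAt i x) : ℕ) : ℤ) = cubeIndex r x - 2 ^ (i : ℕ) := by
  have hrest : ∑ l ∈ Finset.univ.erase i, (signDigit (flipAt i x l) : ℕ) * 2 ^ (l : ℕ) =
      ∑ l ∈ Finset.univ.erase i, (signDigit (x l) : ℕ) * 2 ^ (l : ℕ) :=
    Finset.sum_congr rfl fun l hl => by rw [flipAt_of_ne (Finset.ne_of_mem_erase hl)]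
  have hne : (signDigit (-x i) : ℕ) ≠ signDigit (x i) := by
    intro h
    have := signDigit.injective (Fin.ext h)
    rcases Int.units_eq_one_or (x i) with h | h <;> simp [h] at this
  rw [cubeIndex_val, cubeIndex_val, ← Finset.add_sum_erase _ _ (Finset.mem_univ i), hrest,
    ← Finset.add_sum_erase _ (fun l => (signDigit (x l) : ℕ) * 2 ^ (l : ℕ)) (Finset.mem_univ i),
    flipAt_same]
  generalize signDigit (-x i) = a at hne
  generalize signDigit (x i) = b at hne
  generalize ∑ l ∈ Finset.univ.erase i, (signDigit (x l) : ℕ) * 2 ^ (l : ℕ) = R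
  fin_cases a <;> fin_cases b <;> simp at hne ⊢
  exact Or.inl (add_comm _ _)

/-- The address map that reduces the binary number of the address modulo `m`. -/
def modAddress (r : ℕ) {m M : ℕ} (hm : 0 < m) (hmM : m ≤ M) (x : Cube r) : Fin M :=
  ⟨cubeIndex r x % m, (Nat.mod_lt _ hm).trans_le hmM⟩

/-- Flipping a bit changes the binary number by a power of two, which is never divisible by `3`. -/
theorem modAddress_flipAt_ne {r m M : ℕ} (hm : 0 < m) (hmM : m ≤ M) (h3 : 3 ∣ m) (x : Cube r)
    (i : Fin r) : modAddress r hm hmM (flipAt i x) ≠ modAddress r hm hmM x := by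
  intro h
  have hmod : (cubeIndex r (flipAt i x) : ℕ) ≡ cubeIndex r x [MOD 3] :=
    Nat.ModEq.of_dvd h3 (congrArg Fin.val h)
  have hdvd : (3 : ℤ) ∣ cubeIndex r x - cubeIndex r (flipAt i x) := (Nat.modEq_iff_dvd).1 hmod
  have h2 : (3 : ℤ) ∣ 2 ^ (i : ℕ) := by
    obtain ⟨q, hq⟩ := hdvd
    rcases cubeIndex_flipAt i x with h | h
    · exact ⟨-q, by linarith⟩
    · exact ⟨q, by linarith⟩
  have := Int.prime_three.dvd_of_dvd_pow h2
  omega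

theorem fiberCard_modAddress_le {r m M : ℕ} (hm : 0 < m) (hmM : m ≤ M) (j : Fin M) :
    fiberCard (modAddress r hm hmM) j ≤ 2 ^ r / m + 1 := by
  have hcount : Nat.count (fun a => a ≡ j [MOD m]) (2 ^ r) ≤ 2 ^ r / m + 1 := by
    rw [Nat.count_modEq_card _ hm]
    split_ifs <;> omega
  refine le_trans ?_ hcount
  rw [Nat.count_eq_card_filter_range, fiberCard]
  refine Finset.card_le_card_of_injOn (fun x => (cubeIndex r x : ℕ)) ?_ ?_
  · intro x hx
    have hx' : modAddress r hm hmM x = j := by simpa using hx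
    have hval : (cubeIndex r x : ℕ) % m = j := congrArg Fin.val hx'
    simp only [Finset.coe_filter, Finset.mem_range, Set.mem_ofPred_eq]
    refine ⟨(cubeIndex r x).2, ?_⟩
    rw [Nat.ModEq, ← hval, Nat.mod_mod]
  · intro x _ y _ hxy
    exact (cubeIndex r).injective (Fin.ext hxy)

/-- As `m ≤ 2 ^ r`, rounding up at most doubles the average fiber size; `k ≤ 2 * m` gives the other
factor `2`. -/
theorem fiberCard_modAddress_div_le {r m M k : ℕ} (hm : 0 < m) (hmM : m ≤ M) (hmr : m ≤ 2 ^ r)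
    (hk : 0 < k) (hkm : k ≤ 2 * m) (j : Fin M) :
    (fiberCard (modAddress r hm hmM) j / 2 ^ r : ℝ) ≤ 4 / k := by
  have h1 : fiberCard (modAddress r hm hmM) j * m ≤ 2 * 2 ^ r := by
    have := Nat.mul_le_mul_right m (fiberCard_modAddress_le (r := r) hm hmM j)
    have hdiv := Nat.div_mul_le_self (2 ^ r) m
    linarith
  have h2 : fiberCard (modAddress r hm hmM) j * k ≤ 4 * 2 ^ r := by
    have := Nat.mul_le_mul_left (fiberCard (modAddress r hm hmM) j) hkm
    linarith
  rw [div_le_div_iff₀ (by positivity) (by exact_mod_cast hk)]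
  exact_mod_cast h2

/-! ### The lower bound -/

/-- Without calls the output cannot distinguish a constant from the full parity. This settles small
`k`. -/
theorem FSAlgorithm.pos_of_testsJunta {n k N : ℕ} {ε : ℝ} (hk : k < n) (hε : ε ≤ 1 / 6)
    {A : FSAlgorithm n} (hA : A.TestsJunta k ε) (hN : A.MakesAtMost N) : 0 < N := by
  rcases Nat.eq_zero_or_pos N with rfl | h
  · have h1 := two_thirds_le_sum hN (hA.1 1 (isJunta_one k))
    have h2 := two_thirds_le_sum hN (hA.2 _ (farFromJuntas_prod hk hε))
    simp only [Finset.univ_eq_empty, Finset.prod_empty, one_mul] at h1 h2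
    rw [Fintype.sum_unique] at h1 h2
    exact absurd ((add_le_add h1 h2).trans (A.outputProb_add_le_one _)) (by norm_num)
  · exact h

/-- The combination of balanced address maps with few and with many data bits. -/
theorem FSAlgorithm.le_sq_of_testsJunta {r M k t N : ℕ} {ε : ℝ} (hε : ε ≤ 1 / 6)
    (hrk : 2 * r ≤ k) (hk : 0 < k) (hkr : k ^ 2 ≤ 2 ^ r) (ht : k - r + 2 ≤ 2 * t) (htk : 2 * t ≤ k)
    (htM : 3 * t ≤ M) {A : FSAlgorithm (r + M)} (hA : A.TestsJunta k ε) (hN : A.MakesAtMost N) :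
    (1 : ℝ) / 6 ≤ N ^ 2 * (4 / k) := by
  by_contra hcon
  have hNβ : (N : ℝ) ^ 2 * (4 / k) < 1 / 6 := not_le.1 hcon
  have hβ0 : (0 : ℝ) ≤ 4 / k := by positivity
  have hkk : k ≤ 2 ^ r := le_trans (by nlinarith) hkr
  have hK : 0 < k - r := by omega
  have hKM : k - r ≤ M := by omega
  have hm : 0 < 3 * t := by omega
  have htr : 3 * t * t ≤ 2 ^ r := le_trans (by nlinarith) hkr
  have h3t : 3 * t ≤ 2 ^ r := le_trans (by nlinarith) htr
  have hyes := half_card_lt_sum_fresh (N := N) (modAddress r hK hKM) hβ0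
    (fiberCard_modAddress_div_le hK hKM (by omega) hk (by omega)) hNβ
    (w := A.outputProb true) (A.outputProb_le_one true) fun π s =>
      two_thirds_le_sum hN (hA.1 _ (isJunta_addressing _ s
        ((Finset.univ.filter fun j : Fin M => (j : ℕ) < k - r).map π.toEmbedding)
        (fun x => Finset.mem_map_of_mem _
          (by simpa [modAddress] using Nat.mod_lt _ hK))
        (by
          rw [Finset.card_map, Fin.card_filter_val_lt]
          omega)))
  -- With `q` the quotient, `6 * (t - 1) * (q + 1) ≤ 6 * t * q` as soon as `t ≤ q + 1`. The `+ 2` in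
  -- `ht` provides the `t - 1`, which absorbs the rounding of the fibers; `q ≥ t` comes from `k ^ 2
  -- ≤ 2 ^ r`.
  have hcov : 3 * ((k - r) * (2 ^ r / (3 * t) + 1)) ≤ 2 * 2 ^ r := by
    have hdiv := Nat.div_mul_le_self (2 ^ r) (3 * t)
    have hkt : k - r ≤ 2 * t - 2 := by omega
    refine (Nat.mul_le_mul_left 3 (Nat.mul_le_mul_right _ hkt)).trans ?_
    have hq : t ≤ 2 ^ r / (3 * t) := (Nat.le_div_iff_mul_le hm).2 (by linarith)
    generalize 2 ^ r / (3 * t) = q at *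
    obtain ⟨u, rfl⟩ : ∃ u, t = u + 1 := ⟨t - 1, by omega⟩
    rw [show 2 * (u + 1) - 2 = 2 * u by omega]
    nlinarith
  have hno := half_card_lt_sum_fresh (N := N) (modAddress r hm htM) hβ0
    (fiberCard_modAddress_div_le hm htM h3t hk (by omega)) hNβ
    (w := A.outputProb false) (A.outputProb_le_one false) fun π s =>
      two_thirds_le_sum hN (hA.2 _ (farFromJuntas_addressing _ s
        (fun x i h => modAddress_flipAt_ne hm htM (Dvd.intro _ rfl) x i (π.injective h))
        (fun j => by
          rw [fiberCard_perm_comp]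
          exact fiberCard_modAddress_le hm htM _)
        hcov hε))
  have hsum := Finset.sum_le_sum fun (v : FreshSample N r M) (_ : v ∈ Finset.univ) =>
    A.outputProb_add_le_one v.responses
  rw [Finset.sum_add_distrib, Finset.sum_const, Finset.card_univ, nsmul_eq_mul, mul_one] at hsum
  linarith

/-- With `r = 2 * Nat.clog 2 k` address bits, this leaves at least half of the `k` variables for
data. -/
theorem four_mul_clog_le {k : ℕ} (hk : 32 ≤ k) : 4 * Nat.clog 2 k ≤ k := by
  have h1 : 2 ^ (Nat.clog 2 k).pred < k := Nat.pow_pred_clog_lt_self (by norm_num) (by omega)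
  have h2 : ∀ c, 4 * (c + 6) ≤ 2 ^ (c + 5) := by
    intro c
    induction c with
    | zero => norm_num
    | succ c ih =>
      rw [show c + 1 + 5 = (c + 5) + 1 by ring, pow_succ]
      omega
  by_cases hc : 6 ≤ Nat.clog 2 k
  · obtain ⟨c, hc'⟩ := Nat.exists_eq_add_of_le' hc
    have := h2 c
    rw [hc'] at h1 ⊢
    simp only [Nat.pred_eq_sub_one, show c + 6 - 1 = c + 5 by omega] at h1
    omega
  · omega

end

theorem mainTheorem2 :
    ∃ c : ℝ, 0 < c ∧
      ∀ (n k : ℕ) (ε : ℝ), 3 * k ≤ 2 * n → 0 < ε → ε ≤ 1 / 6 →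
        ∀ (A : FSAlgorithm n) (N : ℕ), A.TestsJunta k ε → A.MakesAtMost N →
          c * Real.sqrt (k : ℝ) ≤ (N : ℝ) := by
  -- Large `k` gives `k ≤ 24 * N ^ 2`; for `k < 32` only `1 ≤ N` is known, so `36 = 6 ^ 2` covers
  -- both.
  refine ⟨1 / 6, by norm_num, fun n k ε hn _ hε A N hA hN => ?_⟩
  suffices h : (k : ℝ) ≤ 36 * (N : ℝ) ^ 2 by
    have h1 : Real.sqrt k ≤ 6 * N := Real.sqrt_le_iff.2 ⟨by positivity, by nlinarith⟩
    linarith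
  rcases Nat.eq_zero_or_pos k with rfl | hk
  · simp only [Nat.cast_zero]
    positivity
  rcases lt_or_ge k 32 with hk32 | hk32
  · have hN1 : (1 : ℝ) ≤ N := by
      exact_mod_cast FSAlgorithm.pos_of_testsJunta (by omega) hε hA hN
    have : (k : ℝ) < 32 := by exact_mod_cast hk32
    nlinarith
  · have hclog := four_mul_clog_le hk32
    have hpow : k ≤ 2 ^ Nat.clog 2 k := Nat.le_pow_clog (by norm_num) k
    -- Needed for `3 * t ≤ M`: rounding in `t` can cost `9 / 2` data bits beyond `3 * (k - 2 * c) /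
    -- 2`, and the available slack is `c`.
    have hclog5 : 5 ≤ Nat.clog 2 k := 
      (Nat.lt_clog_iff_pow_lt (by norm_num)).2 (by omega)
    generalize Nat.clog 2 k = c at *
    have hkr : k ^ 2 ≤ 2 ^ (2 * c) := by
      rw [mul_comm, pow_mul]
      exact Nat.pow_le_pow_left hpow 2
    obtain ⟨M, rfl⟩ : ∃ M, n = 2 * c + M := ⟨n - 2 * c, by omega⟩
    -- This `t` is the least with `k - r + 2 ≤ 2 * t`.
    have h := FSAlgorithm.le_sq_of_testsJunta (t := (k - 2 * c + 3) / 2) hε (by omega) hk hkr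
      (by omega) (by omega) (by omega) hA hN
    have hk' : (0 : ℝ) < k := by exact_mod_cast hk
    rw [mul_div_assoc', le_div_iff₀ hk'] at h
    nlinarith
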